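/- Let $\alpha$ be an irrational real number, and let $(Y_n)_{n\ge 1}$ be a Markov chain on the circle $\mathbb S^1=\mathbb R/\mathbb Z$, defined on some probability space, with transition kernel $$p(x,\cdot)=\tfrac12\,\delta_{x+\alpha}+\tfrac12\,\delta_{x-\alpha}$$ and with $Y_1$ distributed according to the Lebesgue measure on $\mathbb S^1$. Let $\varphi:\mathbb S^1\to\mathbb R$ be a non-constant real trigonometric polynomial, i.e. a real-valued finite linear combination of the functions $x\mapsto e^{2\pi i n x}$, $n\in\mathbb Z$, with $\int_{\mathbb S^1}\varphi(x)\,dx=0$. Then there exists $\sigma>0$, depending only on $\alpha$ and $\varphi$, such that $$\frac{\varphi(Y_1)+\cdots+\varphi(Y_n)}{\sqrt n}\Longrightarrow \mathcal N(0,\sigma^2)\qquad\text{in distribution as } n\to\infty,$$ where $\mathcal N(0,\sigma^2)$ is the normal law with mean $0$ and variance $\sigma^2$. -/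

import Mathlib

open MeasureTheory ProbabilityTheory Filter
open scoped ENNReal

noncomputable section

/-- The transition kernel `p(x, ·) = ½ δ_{x+α} + ½ δ_{x-α}` on the circle `ℝ/ℤ`. -/
def rotationKernel (α : ℝ) : Kernel UnitAddCircle UnitAddCircle where
  toFun x := (2⁻¹ : ℝ≥0∞) • Measure.dirac (x + (α : UnitAddCircle)) +
    (2⁻¹ : ℝ≥0∞) • Measure.dirac (x - (α : UnitAddCircle))
  measurable' := by
    refine Measure.measurable_of_measurable_coe _ fun s hs => ?_
    simp only [Measure.coe_add, Measure.coe_smul, Pi.add_apply, Pi.smul_apply, smul_eq_mul,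
      Measure.dirac_apply' _ hs]
    have h : Measurable (s.indicator (1 : UnitAddCircle → ℝ≥0∞)) := measurable_one.indicator hs
    exact ((h.comp (measurable_id.add_const _)).const_mul _).add
      ((h.comp (measurable_id.sub_const _)).const_mul _)

/-- `Y 0, Y 1, …` is a (time-homogeneous) Markov chain on the probability space `(Ω, P)`, with
transition kernel `p` and initial distribution `ν`: `Y 0` has law `ν`, and the conditional
probability of `Y (n+1) ∈ A` given `Y 0, …, Y n` is `p (Y n, A)`. -/
structure IsMarkovChain {S Ω : Type*} [MeasurableSpace S] [MeasurableSpace Ω]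
    (p : Kernel S S) (ν : Measure S) (P : Measure Ω) (Y : ℕ → Ω → S) : Prop where
  measurable : ∀ n, Measurable (Y n)
  initial : P.map (Y 0) = ν
  markov : ∀ (n : ℕ) (A : Set S), MeasurableSet A →
    P[(Y (n + 1) ⁻¹' A).indicator (fun _ => (1 : ℝ)) |
        ⨆ k ∈ Finset.range (n + 1), MeasurableSpace.comap (Y k) inferInstance]
      =ᵐ[P] fun ω => (p (Y n ω)).real A

/-- A real-valued trigonometric polynomial on the circle `ℝ/ℤ`: a finite linear combination of the
characters `x ↦ exp (2πinx)`, `n ∈ ℤ`, with complex coefficients, all of whose values are real. -/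
def IsTrigPolynomial (φ : UnitAddCircle → ℝ) : Prop :=
  ∃ c : ℤ →₀ ℂ, ∀ x, (φ x : ℂ) = ∑ n ∈ c.support, c n * fourier n x

end

/-!
Solve the Poisson equations `ψ - Pψ = φ - ∫ φ` and `b - Pb = V - v`, where `P` is the Markov
operator of the kernel `p`, `V x = Var[ψ; p x]` and `v = ∫ V`. For trigonometric polynomials these
only take finitely many divisions by the eigenvalues `1 - cos (2πnα) ≠ 0`, `n ≠ 0`, of `1 - P`.
Expanding to second order in `s`, the function `u = e^{isψ} (1 - s² b / 2)` satisfies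
`e^{is(φ - ∫ φ)} Pu = (1 - s² v / 2) u + O(s³)`. Iterating `n` times with `s = t / √n` shows that
the characteristic function of the normalized sum tends to `lim (1 - t² v / (2n))ⁿ = e^{-t² v / 2}`.
The variance `v` is positive, for otherwise `ψ` would be invariant under the rotation by `2α`, hence
constant by density of the orbits.
-/

/-- The σ-algebra generated by `Y 0, …, Y n`, which `IsMarkovChain.markov` conditions on. -/
abbrev pastSigmaAlgebra {S Ω : Type*} [MeasurableSpace S] (Y : ℕ → Ω → S) (n : ℕ) :
    MeasurableSpace Ω :=
  ⨆ k ∈ Finset.range (n + 1), MeasurableSpace.comap (Y k) inferInstance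

lemma measurable_pastSigmaAlgebra {S Ω : Type*} [MeasurableSpace S] (Y : ℕ → Ω → S) {n k : ℕ}
    (hk : k ≤ n) : Measurable[pastSigmaAlgebra Y n] (Y k) :=
  measurable_iff_comap_le.2 (le_iSup₂_of_le k (Finset.mem_range_succ_iff.2 hk) le_rfl)

namespace IsMarkovChain

variable {S Ω E : Type*} [MeasurableSpace S] [mΩ : MeasurableSpace Ω]
  [NormedAddCommGroup E] [NormedSpace ℝ E]
  {p : Kernel S S} {ν : Measure S} {P : Measure Ω} {Y : ℕ → Ω → S}

lemma pastSigmaAlgebra_le (h : IsMarkovChain p ν P Y) (n : ℕ) : pastSigmaAlgebra Y n ≤ mΩ :=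
  iSup₂_le fun k _ => (h.measurable k).comap_le

variable [IsProbabilityMeasure P]

lemma measureReal_inter_preimage_succ (h : IsMarkovChain p ν P Y) (n : ℕ) {A : Set S}
    (hA : MeasurableSet A) {B : Set Ω} (hB : MeasurableSet[pastSigmaAlgebra Y n] B) :
    P.real (Y (n + 1) ⁻¹' A ∩ B) = ∫ ω in B, (p (Y n ω)).real A ∂P := by
  have hYA : MeasurableSet (Y (n + 1) ⁻¹' A) := h.measurable _ hA
  calc P.real (Y (n + 1) ⁻¹' A ∩ B)
      = ∫ ω in B, (Y (n + 1) ⁻¹' A).indicator (fun _ => (1 : ℝ)) ω ∂P := by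
        rw [integral_indicator hYA, setIntegral_const, smul_eq_mul, mul_one, measureReal_def,
          measureReal_def, Measure.restrict_apply hYA]
    _ = ∫ ω in B, (p (Y n ω)).real A ∂P := by
        rw [← setIntegral_condExp (h.pastSigmaAlgebra_le n)
          ((integrable_const _).indicator hYA) hB]
        exact setIntegral_congr_ae (h.pastSigmaAlgebra_le n B hB)
          ((h.markov n A hA).mono fun _ hω _ => hω)

variable [IsMarkovKernel p]

lemma map_restrict_succ (h : IsMarkovChain p ν P Y) (n : ℕ) {B : Set Ω}
    (hB : MeasurableSet[pastSigmaAlgebra Y n] B) :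
    (P.restrict B).map (Y (n + 1)) = p ∘ₘ (P.restrict B).map (Y n) := by
  ext A hA
  rw [Measure.map_apply (h.measurable _) hA, Measure.bind_apply hA p.measurable.aemeasurable,
    lintegral_map (p.measurable_coe hA) (h.measurable n),
    Measure.restrict_apply (h.measurable _ hA), ← ofReal_measureReal,
    h.measureReal_inter_preimage_succ n hA hB, ofReal_integral_eq_lintegral_ofReal]
  · exact lintegral_congr fun _ => ofReal_measureReal
  · refine .of_bound (C := 1)
      ((p.measurable_coe hA).ennreal_toReal.comp (h.measurable n)).aestronglyMeasurable
      (ae_of_all _ fun _ => ?_)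
    rw [Real.norm_of_nonneg measureReal_nonneg]
    exact measureReal_le_one
  · exact ae_of_all _ fun _ => measureReal_nonneg

lemma setIntegral_comp_succ (h : IsMarkovChain p ν P Y) (n : ℕ) {f : S → E}
    (hf : StronglyMeasurable f) (hfi : Integrable (fun ω => f (Y (n + 1) ω)) P) {B : Set Ω}
    (hB : MeasurableSet[pastSigmaAlgebra Y n] B) :
    IntegrableOn (fun ω => ∫ y, f y ∂p (Y n ω)) B P ∧
      ∫ ω in B, f (Y (n + 1) ω) ∂P = ∫ ω in B, ∫ y, f y ∂p (Y n ω) ∂P := by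
  have hfB : Integrable f ((p ∘ₖ Kernel.const Unit ((P.restrict B).map (Y n))) ()) := by
    rw [← Measure.comp_eq_comp_const_apply, ← h.map_restrict_succ n hB,
      integrable_map_measure hf.aestronglyMeasurable (h.measurable _).aemeasurable]
    exact hfi.integrableOn
  refine ⟨hfB.integral_comp.comp_measurable (h.measurable n), ?_⟩
  rw [← integral_map (h.measurable _).aemeasurable hf.aestronglyMeasurable,
    h.map_restrict_succ n hB, Measure.comp_eq_comp_const_apply, Kernel.integral_comp hfB,
    Kernel.const_apply]
  exact integral_map (h.measurable _).aemeasurable hf.integral_kernel.aestronglyMeasurable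

lemma condExp_comp_succ [CompleteSpace E] (h : IsMarkovChain p ν P Y) (n : ℕ) {f : S → E}
    (hf : StronglyMeasurable f) (hfi : Integrable (fun ω => f (Y (n + 1) ω)) P) :
    P[fun ω => f (Y (n + 1) ω) | pastSigmaAlgebra Y n] =ᵐ[P] fun ω => ∫ y, f y ∂p (Y n ω) :=
  (ae_eq_condExp_of_forall_setIntegral_eq (h.pastSigmaAlgebra_le n) hfi
    (fun _ hB _ => (h.setIntegral_comp_succ n hf hfi hB).1)
    (fun _ hB _ => (h.setIntegral_comp_succ n hf hfi hB).2.symm)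
    (hf.integral_kernel.comp_measurable
      (measurable_pastSigmaAlgebra Y le_rfl)).aestronglyMeasurable).symm

lemma integral_mul_comp_succ (h : IsMarkovChain p ν P Y) (n : ℕ) {G : Ω → ℂ}
    (hG : StronglyMeasurable[pastSigmaAlgebra Y n] G) {f : S → ℂ} (hf : StronglyMeasurable f)
    (hfi : Integrable (fun ω => f (Y (n + 1) ω)) P)
    (hGf : Integrable (fun ω => G ω * f (Y (n + 1) ω)) P) :
    ∫ ω, G ω * f (Y (n + 1) ω) ∂P = ∫ ω, G ω * ∫ y, f y ∂p (Y n ω) ∂P := by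
  rw [← integral_condExp (h.pastSigmaAlgebra_le n)]
  refine integral_congr_ae ?_
  filter_upwards [condExp_bilin_of_stronglyMeasurable_left (ContinuousLinearMap.mul ℝ ℂ) hG hGf hfi,
    h.condExp_comp_succ n hf hfi] with ω hpull hstep
  exact hpull.trans (congrArg (G ω * ·) hstep)

end IsMarkovChain

open Complex in
lemma norm_exp_mul_I_sub_taylor_le (x : ℝ) :
    ‖cexp (x * I) - (1 + x * I - x ^ 2 / 2)‖ ≤ |x| ^ 3 * Real.exp |x| := by
  have h := norm_exp_sub_sum_le_norm_mul_exp (x * I) 3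
  have htaylor : ∑ m ∈ Finset.range 3, (x * I) ^ m / (m.factorial : ℂ) = 1 + x * I - x ^ 2 / 2 := by
    simp only [mul_pow, Finset.sum_range_succ, Finset.range_one, Finset.sum_singleton, pow_zero,
      mul_one, Nat.factorial, Nat.cast_one, ne_eq, one_ne_zero, not_false_eq_true, div_self,
      pow_one, Nat.succ_eq_add_one, zero_add, div_one, I_sq, mul_neg, Nat.reduceAdd,
      Nat.cast_ofNat]
    ring
  rwa [htaylor, norm_mul, norm_I, mul_one, norm_real, Real.norm_eq_abs] at h

lemma norm_exp_mul_I_sub_one_le (x : ℝ) : ‖Complex.exp (x * Complex.I) - 1‖ ≤ |x| := by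
  rw [mul_comm]
  exact Real.norm_exp_I_mul_ofReal_sub_one_le

open Complex in
lemma norm_exp_mul_I_mul_one_sub_sub_le {s x y A B : ℝ} (hs : |s| ≤ 1) (hx : |x| ≤ A)
    (hy : |y| ≤ B) :
    ‖cexp ((s * x : ℝ) * I) * (1 - s ^ 2 / 2 * y) - (1 + s * x * I - s ^ 2 / 2 * (x ^ 2 + y : ℝ))‖
      ≤ (A ^ 3 * Real.exp A + A * B / 2) * |s| ^ 3 := by
  have hA : 0 ≤ A := (abs_nonneg x).trans hx
  have hB : 0 ≤ B := (abs_nonneg y).trans hy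
  have hsx : |s * x| ≤ |s| * A := by
    rw [abs_mul]
    gcongr
  have hsxA : |s * x| ≤ A := hsx.trans (mul_le_of_le_one_left hA hs)
  have hy' : ‖-(s ^ 2 / 2 * y : ℂ)‖ ≤ |s| ^ 2 / 2 * B := by
    rw [norm_neg, norm_mul, norm_div, norm_pow, norm_real, norm_real, Complex.norm_ofNat]
    simp only [Real.norm_eq_abs]
    gcongr
  have hsplit :
      cexp ((s * x : ℝ) * I) * (1 - s ^ 2 / 2 * y) - (1 + s * x * I - s ^ 2 / 2 * (x ^ 2 + y : ℝ)) =
        (cexp ((s * x : ℝ) * I) - (1 + (s * x : ℝ) * I - ((s * x : ℝ) : ℂ) ^ 2 / 2)) +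
          -(s ^ 2 / 2 * y) * (cexp ((s * x : ℝ) * I) - 1) := by
    push_cast
    ring
  calc _ ≤ |s * x| ^ 3 * Real.exp |s * x| + |s| ^ 2 / 2 * B * |s * x| := by
        rw [hsplit]
        refine norm_add_le_of_le (norm_exp_mul_I_sub_taylor_le _) ?_
        rw [norm_mul]
        exact mul_le_mul hy' (norm_exp_mul_I_sub_one_le _) (norm_nonneg _) (by positivity)
    _ ≤ (|s| * A) ^ 3 * Real.exp A + |s| ^ 2 / 2 * B * (|s| * A) := by gcongr
    _ = _ := by ring

open Complex in
lemma norm_integral_exp_mul_sub_le {S : Type*} [MeasurableSpace S] {μ : Measure S}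
    [IsProbabilityMeasure μ] {f g : S → ℝ} {A B s : ℝ} (hf : AEStronglyMeasurable f μ)
    (hg : AEStronglyMeasurable g μ) (hfA : ∀ x, |f x| ≤ A) (hgB : ∀ x, |g x| ≤ B)
    (hf0 : ∫ x, f x ∂μ = 0) (hs : |s| ≤ 1) :
    ‖∫ x, cexp ((s * f x : ℝ) * I) * (1 - (s : ℂ) ^ 2 / 2 * g x) ∂μ -
        (1 - (s : ℂ) ^ 2 / 2 * (∫ x, f x ^ 2 ∂μ + ∫ x, g x ∂μ : ℝ))‖
      ≤ (A ^ 3 * Real.exp A + A * B / 2) * |s| ^ 3 := by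
  have hfi : Integrable f μ := .of_bound hf A (ae_of_all _ hfA)
  have hgi : Integrable g μ := .of_bound hg B (ae_of_all _ hgB)
  have hf2i : Integrable (fun x => f x ^ 2) μ :=
    .of_bound (hf.pow 2) (A ^ 2) (ae_of_all _ fun x => by
      rw [Real.norm_eq_abs, abs_pow]
      exact pow_le_pow_left₀ (abs_nonneg _) (hfA x) 2)
  have hexp : Integrable (fun x => cexp ((s * f x : ℝ) * I)) μ :=
    .of_bound (by fun_prop) 1 (ae_of_all _ fun x => (norm_exp_ofReal_mul_I _).le)
  have hmain : Integrable (fun x => cexp ((s * f x : ℝ) * I) * (1 - s ^ 2 / 2 * g x)) μ :=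
    ((integrable_const (1 : ℂ)).sub (hgi.ofReal.const_mul _)).bdd_mul hexp.aestronglyMeasurable
      (ae_of_all _ fun x => (norm_exp_ofReal_mul_I _).le)
  have hquad : Integrable (fun x => s * f x * I - s ^ 2 / 2 * (f x ^ 2 + g x : ℝ)) μ :=
    ((hfi.ofReal.const_mul _).mul_const _).sub ((hf2i.add hgi).ofReal.const_mul _)
  have hint : ∫ x, (1 + s * f x * I - s ^ 2 / 2 * (f x ^ 2 + g x : ℝ)) ∂μ =
      1 - (s : ℂ) ^ 2 / 2 * (∫ x, f x ^ 2 ∂μ + ∫ x, g x ∂μ : ℝ) := by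
    simp_rw [add_sub_assoc]
    rw [integral_add (integrable_const _) hquad, integral_sub
      ((hfi.ofReal.const_mul _).mul_const _) ((hf2i.add hgi).ofReal.const_mul _),
      integral_mul_const, integral_const_mul, integral_const_mul, integral_complex_ofReal,
      integral_complex_ofReal, integral_add hf2i hgi, hf0]
    simp [sub_eq_add_neg]
  have hpoly : Integrable (fun x => 1 + s * f x * I - s ^ 2 / 2 * (f x ^ 2 + g x : ℝ)) μ := by
    simpa only [add_sub_assoc, Pi.add_def] using (integrable_const (1 : ℂ)).add hquad
  rw [← hint, ← integral_sub hmain hpoly]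
  refine (norm_integral_le_of_norm_le_const (ae_of_all _ fun x =>
    norm_exp_mul_I_mul_one_sub_sub_le hs (hfA x) (hgB x))).trans_eq (by simp)

/-- `g` is a bounded measurable solution of the Poisson equation `g - Pg = f`, where
`Pg x = ∫ y, g y ∂p x` is the Markov operator of the kernel `p`. -/
structure IsPoissonSolution {S : Type*} [MeasurableSpace S] (p : Kernel S S) (f g : S → ℝ) :
    Prop where
  measurable : Measurable g
  bounded : ∃ C, ∀ x, |g x| ≤ C
  sub_integral_eq : ∀ x, g x - ∫ y, g y ∂p x = f x

/-- The Fourier perturbation `u ↦ e^{iφ} Pu` of the Markov operator `P` of the kernel `p`. Its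
iterates compute the characteristic functions of the sums of `φ` along a Markov chain. -/
noncomputable def twistedOperator {S : Type*} [MeasurableSpace S] (p : Kernel S S)
    (φ : S → ℝ) (u : S → ℂ) (x : S) : ℂ :=
  Complex.exp (φ x * Complex.I) * ∫ y, u y ∂p x

/-- The function `e^{isψ} (1 - s² b / 2)`, which, for suitable solutions `ψ` and `b` of Poisson
equations, is an eigenfunction of `twistedOperator p (s φ)` up to an error of order `s³`. -/
noncomputable def approxEigenfunction {S : Type*} (ψ b : S → ℝ) (s : ℝ) (x : S) : ℂ :=
  Complex.exp ((s * ψ x : ℝ) * Complex.I) * (1 - (s : ℂ) ^ 2 / 2 * b x)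

lemma norm_approxEigenfunction_sub_one_le {S : Type*} {ψ b : S → ℝ} {A B s : ℝ} {x : S}
    (hA : |ψ x| ≤ A) (hB : |b x| ≤ B) (hs : |s| ≤ 1) :
    ‖approxEigenfunction ψ b s x - 1‖ ≤ (A + B / 2) * |s| := by
  have hsplit : approxEigenfunction ψ b s x - 1 = (Complex.exp ((s * ψ x : ℝ) * Complex.I) - 1) +
      Complex.exp ((s * ψ x : ℝ) * Complex.I) * -((s ^ 2 / 2 * b x : ℝ) : ℂ) := by
    rw [approxEigenfunction]
    push_cast
    ring
  have hs2 : s ^ 2 ≤ |s| := by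
    rw [← sq_abs]
    exact pow_le_of_le_one (abs_nonneg s) hs two_ne_zero
  calc ‖approxEigenfunction ψ b s x - 1‖ ≤ |s * ψ x| + |s ^ 2 / 2 * b x| := by
        rw [hsplit]
        refine norm_add_le_of_le (norm_exp_mul_I_sub_one_le _) ?_
        rw [norm_mul, Complex.norm_exp_ofReal_mul_I, one_mul, norm_neg, Complex.norm_real,
          Real.norm_eq_abs]
    _ = |s| * |ψ x| + s ^ 2 / 2 * |b x| := by
        rw [abs_mul, abs_mul, abs_of_nonneg (by positivity : 0 ≤ s ^ 2 / 2)]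
    _ ≤ |s| * A + |s| / 2 * B := by gcongr
    _ = (A + B / 2) * |s| := by ring

section PoissonEquation

variable {S : Type*} [MeasurableSpace S] {p : Kernel S S} {φ ψ b : S → ℝ} {v : ℝ}

lemma IsPoissonSolution.measurable_source [IsSFiniteKernel p] (h : IsPoissonSolution p φ ψ) :
    Measurable φ := by
  rw [← funext h.sub_integral_eq]
  exact h.measurable.sub h.measurable.stronglyMeasurable.integral_kernel.measurable

lemma measurable_approxEigenfunction (hψ : Measurable ψ) (hb : Measurable b) (s : ℝ) :
    Measurable (approxEigenfunction ψ b s) := by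
  unfold approxEigenfunction
  fun_prop

lemma twistedOperator_approxEigenfunction (hψ : IsPoissonSolution p φ ψ) (b : S → ℝ) (s : ℝ)
    (x : S) :
    twistedOperator p (fun y => s * φ y) (approxEigenfunction ψ b s) x =
      Complex.exp ((s * ψ x : ℝ) * Complex.I) *
        ∫ y, Complex.exp ((s * (ψ y - ∫ z, ψ z ∂p x) : ℝ) * Complex.I) *
          (1 - (s : ℂ) ^ 2 / 2 * b y) ∂p x := by
  simp only [twistedOperator, approxEigenfunction]
  rw [← integral_const_mul, ← integral_const_mul]
  congr 1 with y
  rw [← mul_assoc, ← mul_assoc, ← Complex.exp_add, ← Complex.exp_add, ← hψ.sub_integral_eq x]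
  push_cast
  ring_nf

lemma norm_twistedOperator_approxEigenfunction_sub_le [IsMarkovKernel p] {A B s : ℝ}
    (hψ : IsPoissonSolution p φ ψ) (hb : IsPoissonSolution p (fun x => Var[ψ; p x] - v) b)
    (hA : ∀ x, |ψ x| ≤ A) (hB : ∀ x, |b x| ≤ B) (hs : |s| ≤ 1) (x : S) :
    ‖twistedOperator p (fun y => s * φ y) (approxEigenfunction ψ b s) x -
        (1 - s ^ 2 * v / 2 : ℝ) * approxEigenfunction ψ b s x‖
      ≤ ((A + A) ^ 3 * Real.exp (A + A) + (A + A) * B / 2 + |v| * B / 4) * |s| ^ 3 := by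
  set m : ℝ := ∫ y, ψ y ∂p x
  have hm : |m| ≤ A := by
    simpa using norm_integral_le_of_norm_le_const (μ := p x) (f := ψ) (ae_of_all _ hA)
  have hψi : Integrable ψ (p x) :=
    .of_bound hψ.measurable.aestronglyMeasurable A (ae_of_all _ hA)
  have hcentered : ∫ y, (ψ y - m) ∂p x = 0 := by
    simp [integral_sub hψi (integrable_const m), m]
  have hvar : ∫ y, (ψ y - m) ^ 2 ∂p x + ∫ y, b y ∂p x = v + b x := by
    rw [← variance_eq_integral hψ.measurable.aemeasurable]
    linarith [hb.sub_integral_eq x]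
  have hexpand := norm_integral_exp_mul_sub_le (μ := p x) (f := fun y => ψ y - m)
    (hψ.measurable.sub_const m).aestronglyMeasurable hb.measurable.aestronglyMeasurable
    (fun y => (abs_sub _ _).trans (add_le_add (hA y) hm)) hB hcentered hs
  rw [hvar] at hexpand
  have hquartic : ‖((s ^ 4 * v * b x / 4 : ℝ) : ℂ)‖ ≤ |v| * B / 4 * |s| ^ 3 := by
    have hs4 : |s| ^ 4 ≤ |s| ^ 3 := pow_le_pow_of_le_one (abs_nonneg s) hs (by norm_num)
    rw [Complex.norm_real, Real.norm_eq_abs, abs_div, abs_mul, abs_mul, abs_pow]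
    calc |s| ^ 4 * |v| * |b x| / |4| ≤ |s| ^ 3 * |v| * B / |4| := by
          gcongr
          exact hB x
      _ = |v| * B / 4 * |s| ^ 3 := by
          rw [abs_of_pos (four_pos : (0 : ℝ) < 4)]
          ring
  have hfactor (J : ℂ) : Complex.exp ((s * ψ x : ℝ) * Complex.I) * J -
      (1 - s ^ 2 * v / 2 : ℝ) * approxEigenfunction ψ b s x =
      Complex.exp ((s * ψ x : ℝ) * Complex.I) * ((J - (1 - (s : ℂ) ^ 2 / 2 * (v + b x : ℝ))) -
        (s ^ 4 * v * b x / 4 : ℝ)) := by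
    rw [approxEigenfunction]
    push_cast
    ring
  rw [twistedOperator_approxEigenfunction hψ, hfactor, norm_mul, Complex.norm_exp_ofReal_mul_I,
    one_mul, add_mul _ _ (|s| ^ 3)]
  exact norm_sub_le_of_le hexpand hquartic

end PoissonEquation

lemma norm_integral_exp_mul_le {Ω : Type*} [MeasurableSpace Ω] {P : Measure Ω}
    [IsProbabilityMeasure P] (X : Ω → ℝ) {f : Ω → ℂ} {C : ℝ} (hf : ∀ ω, ‖f ω‖ ≤ C) :
    ‖∫ ω, Complex.exp (X ω * Complex.I) * f ω ∂P‖ ≤ C := by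
  refine (norm_integral_le_of_norm_le_const (C := C) (ae_of_all _ fun ω => ?_)).trans (by simp)
  rw [norm_mul, Complex.norm_exp_ofReal_mul_I, one_mul]
  exact hf ω

lemma tendsto_div_sqrt_of_norm_sub_pow_le {F : ℝ → ℕ → ℂ} {v K : ℝ}
    (hF : ∀ (s : ℝ) (n : ℕ), |s| ≤ 1 → s ^ 2 * v ≤ 2 →
      ‖F s n - ((1 - s ^ 2 * v / 2 : ℝ) : ℂ) ^ n‖ ≤ K * (n * |s| ^ 3 + |s|)) (t : ℝ) :
    Tendsto (fun n : ℕ => F (t / √(n : ℝ)) n) atTop (nhds (Complex.exp (-(v * t ^ 2 / 2)))) := by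
  have hs : Tendsto (fun n : ℕ => t / √(n : ℝ)) atTop (nhds 0) :=
    tendsto_const_nhds.div_atTop (Real.tendsto_sqrt_atTop.comp tendsto_natCast_atTop_atTop)
  have hs_abs : Tendsto (fun n : ℕ => |t / √(n : ℝ)|) atTop (nhds 0) := by simpa using hs.abs
  have hs_sq (n : ℕ) : (t / √(n : ℝ)) ^ 2 = t ^ 2 / n := by
    rw [div_pow, Real.sq_sqrt (Nat.cast_nonneg n)]
  have hpow : Tendsto (fun n : ℕ => ((1 - (t / √(n : ℝ)) ^ 2 * v / 2 : ℝ) : ℂ) ^ n) atTop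
      (nhds (Complex.exp (-(v * t ^ 2 / 2)))) := by
    refine (Complex.tendsto_one_add_div_pow_exp (-(v * t ^ 2 / 2))).congr fun n => ?_
    rw [hs_sq]
    push_cast
    ring
  have hdiff : Tendsto (fun n : ℕ => F (t / √(n : ℝ)) n -
      ((1 - (t / √(n : ℝ)) ^ 2 * v / 2 : ℝ) : ℂ) ^ n) atTop (nhds 0) := by
    refine squeeze_zero_norm' (a := fun n : ℕ => K * ((t ^ 2 + 1) * |t / √(n : ℝ)|)) ?_
      (by simpa using (hs_abs.const_mul (t ^ 2 + 1)).const_mul K)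
    have hsv : Tendsto (fun n : ℕ => (t / √(n : ℝ)) ^ 2 * v) atTop (nhds 0) := by
      simpa using (hs.pow 2).mul_const v
    filter_upwards [hs_abs.eventually_le_const one_pos, hsv.eventually_le_const two_pos,
      eventually_ne_atTop 0] with n hs1 hsv2 hn
    have hn_cube : n * |t / √(n : ℝ)| ^ 3 = t ^ 2 * |t / √(n : ℝ)| := by
      rw [pow_succ, sq_abs, hs_sq]
      field_simp
    refine (hF _ n hs1 hsv2).trans_eq ?_
    rw [hn_cube, add_one_mul]
  simpa using hdiff.add hpow

namespace IsMarkovChain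

variable {S Ω : Type*} [MeasurableSpace S] [MeasurableSpace Ω] {p : Kernel S S} {ν : Measure S}
  {P : Measure Ω} {Y : ℕ → Ω → S} {φ : S → ℝ} {u : S → ℂ} {l : ℂ} {δ ε C : ℝ}

lemma measurable_sum (h : IsMarkovChain p ν P Y) (hφ : Measurable φ) (n : ℕ) :
    Measurable fun ω => ∑ k ∈ Finset.range n, φ (Y k ω) :=
  Finset.measurable_fun_sum _ fun k _ => hφ.comp (h.measurable k)

variable [IsProbabilityMeasure P]

lemma integrable_exp_sum_mul (h : IsMarkovChain p ν P Y) (hφ : Measurable φ) (hu : Measurable u)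
    (huC : ∀ x, ‖u x‖ ≤ C) (n m : ℕ) :
    Integrable (fun ω => Complex.exp ((∑ k ∈ Finset.range n, φ (Y k ω) : ℝ) * Complex.I) *
      u (Y m ω)) P := by
  have hS := h.measurable_sum hφ n
  have hY := h.measurable m
  refine .of_bound (by fun_prop) C (ae_of_all _ fun ω => ?_)
  rw [norm_mul, Complex.norm_exp_ofReal_mul_I, one_mul]
  exact huC _

variable [IsMarkovKernel p]

lemma integral_exp_sum_succ_mul (h : IsMarkovChain p ν P Y) (hφ : Measurable φ)
    (hu : Measurable u) (huC : ∀ x, ‖u x‖ ≤ C) (n : ℕ) :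
    ∫ ω, Complex.exp ((∑ k ∈ Finset.range (n + 1), φ (Y k ω) : ℝ) * Complex.I) *
        u (Y (n + 1) ω) ∂P =
      ∫ ω, Complex.exp ((∑ k ∈ Finset.range n, φ (Y k ω) : ℝ) * Complex.I) *
        twistedOperator p φ u (Y n ω) ∂P := by
  have hpast : Measurable[pastSigmaAlgebra Y n] fun ω =>
      Complex.exp ((∑ k ∈ Finset.range (n + 1), φ (Y k ω) : ℝ) * Complex.I) := by
    have hS : Measurable[pastSigmaAlgebra Y n] fun ω => ∑ k ∈ Finset.range (n + 1), φ (Y k ω) :=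
      Finset.measurable_fun_sum _ fun k hk =>
        hφ.comp (measurable_pastSigmaAlgebra Y (Finset.mem_range_succ_iff.1 hk))
    fun_prop
  have hui : Integrable (fun ω => u (Y (n + 1) ω)) P :=
    .of_bound (hu.comp (h.measurable _)).aestronglyMeasurable C (ae_of_all _ fun ω => huC _)
  rw [h.integral_mul_comp_succ n hpast.stronglyMeasurable hu.stronglyMeasurable hui
    (h.integrable_exp_sum_mul hφ hu huC _ _)]
  congr 1 with ω
  rw [twistedOperator, ← mul_assoc, ← Complex.exp_add, Finset.sum_range_succ]
  push_cast
  ring_nf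

lemma norm_integral_exp_sum_succ_mul_sub_le (h : IsMarkovChain p ν P Y) (hφ : Measurable φ)
    (hu : Measurable u) (huC : ∀ x, ‖u x‖ ≤ C)
    (hε : ∀ x, ‖twistedOperator p φ u x - l * u x‖ ≤ ε) (n : ℕ) :
    ‖∫ ω, Complex.exp ((∑ k ∈ Finset.range (n + 1), φ (Y k ω) : ℝ) * Complex.I) *
          u (Y (n + 1) ω) ∂P -
        l * ∫ ω, Complex.exp ((∑ k ∈ Finset.range n, φ (Y k ω) : ℝ) * Complex.I) *
          u (Y n ω) ∂P‖ ≤ ε := by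
  have hLu : Measurable (twistedOperator p φ u) := by
    have hPu := hu.stronglyMeasurable.integral_kernel (κ := p).measurable
    unfold twistedOperator
    fun_prop
  have hLuC (x : S) : ‖twistedOperator p φ u x‖ ≤ C := by
    rw [twistedOperator, norm_mul, Complex.norm_exp_ofReal_mul_I, one_mul]
    simpa using norm_integral_le_of_norm_le_const (μ := p x) (ae_of_all _ huC)
  rw [h.integral_exp_sum_succ_mul hφ hu huC, ← integral_const_mul,
    ← integral_sub (h.integrable_exp_sum_mul hφ hLu hLuC n n)
      ((h.integrable_exp_sum_mul hφ hu huC n n).const_mul l)]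
  simp_rw [mul_left_comm l, ← mul_sub]
  exact norm_integral_exp_mul_le _ fun ω => hε _

lemma norm_integral_exp_sum_mul_sub_pow_le (h : IsMarkovChain p ν P Y) (hφ : Measurable φ)
    (hu : Measurable u) (huC : ∀ x, ‖u x‖ ≤ C) (hl : ‖l‖ ≤ 1)
    (hε : ∀ x, ‖twistedOperator p φ u x - l * u x‖ ≤ ε) (n : ℕ) :
    ‖∫ ω, Complex.exp ((∑ k ∈ Finset.range n, φ (Y k ω) : ℝ) * Complex.I) * u (Y n ω) ∂P -
        l ^ n * ∫ ω, u (Y 0 ω) ∂P‖ ≤ n * ε := by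
  induction n with
  | zero => simp
  | succ n ih =>
    refine (norm_sub_le_norm_sub_add_norm_sub _ (l * ∫ ω, Complex.exp
      ((∑ k ∈ Finset.range n, φ (Y k ω) : ℝ) * Complex.I) * u (Y n ω) ∂P) _).trans ?_
    rw [pow_succ', mul_assoc, ← mul_sub, norm_mul, Nat.cast_succ, add_one_mul, add_comm]
    exact add_le_add ((mul_le_of_le_one_left (norm_nonneg _) hl).trans ih)
      (h.norm_integral_exp_sum_succ_mul_sub_le hφ hu huC hε n)

lemma norm_integral_exp_sum_sub_pow_le (h : IsMarkovChain p ν P Y) (hφ : Measurable φ)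
    (hu : Measurable u) (hδ : ∀ x, ‖u x - 1‖ ≤ δ) (hl : ‖l‖ ≤ 1)
    (hε : ∀ x, ‖twistedOperator p φ u x - l * u x‖ ≤ ε) (n : ℕ) :
    ‖∫ ω, Complex.exp ((∑ k ∈ Finset.range n, φ (Y k ω) : ℝ) * Complex.I) ∂P - l ^ n‖
      ≤ n * ε + 2 * δ := by
  have huC (x : S) : ‖u x‖ ≤ δ + 1 := by
    simpa using norm_add_le_of_le (hδ x) (norm_one (α := ℂ)).le
  have hfinal (n : ℕ) :
      ‖∫ ω, Complex.exp ((∑ k ∈ Finset.range n, φ (Y k ω) : ℝ) * Complex.I) * u (Y n ω) ∂P -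
        ∫ ω, Complex.exp ((∑ k ∈ Finset.range n, φ (Y k ω) : ℝ) * Complex.I) ∂P‖ ≤ δ := by
    have hone := h.integrable_exp_sum_mul hφ (u := 1) measurable_one (C := 1) (by simp) n n
    simp only [Pi.one_apply, mul_one] at hone
    rw [← integral_sub (h.integrable_exp_sum_mul hφ hu huC n n) hone]
    simp_rw [← mul_sub_one]
    exact norm_integral_exp_mul_le _ fun ω => hδ _
  have hinitial : ‖l ^ n * ∫ ω, u (Y 0 ω) ∂P - l ^ n‖ ≤ δ := by
    rw [← mul_sub_one, norm_mul, norm_pow]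
    refine (mul_le_of_le_one_left (norm_nonneg _) (pow_le_one₀ (norm_nonneg _) hl)).trans ?_
    simpa using hfinal 0
  have hpow := h.norm_integral_exp_sum_mul_sub_pow_le hφ hu huC hl hε n
  refine (norm_sub_le_norm_sub_add_norm_sub _ (∫ ω, Complex.exp
    ((∑ k ∈ Finset.range n, φ (Y k ω) : ℝ) * Complex.I) * u (Y n ω) ∂P) _).trans ?_
  refine (add_le_add_right (norm_sub_le_norm_sub_add_norm_sub _ (l ^ n * ∫ ω, u (Y 0 ω) ∂P) _)
    _).trans ?_
  rw [norm_sub_rev]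
  linarith [hfinal n]

variable {ψ b : S → ℝ} {v : NNReal}

lemma exists_norm_integral_exp_mul_sum_sub_pow_le (h : IsMarkovChain p ν P Y)
    (hψ : IsPoissonSolution p φ ψ) (hb : IsPoissonSolution p (fun x => Var[ψ; p x] - v) b) :
    ∃ K, ∀ (s : ℝ) (n : ℕ), |s| ≤ 1 → s ^ 2 * v ≤ 2 →
      ‖∫ ω, Complex.exp ((s * ∑ k ∈ Finset.range n, φ (Y k ω) : ℝ) * Complex.I) ∂P -
        ((1 - s ^ 2 * v / 2 : ℝ) : ℂ) ^ n‖ ≤ K * (n * |s| ^ 3 + |s|) := by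
  obtain ⟨A, hA⟩ := hψ.bounded
  obtain ⟨B, hB⟩ := hb.bounded
  set C : ℝ := (A + A) ^ 3 * Real.exp (A + A) + (A + A) * B / 2 + |(v : ℝ)| * B / 4
  refine ⟨max C (2 * (A + B / 2)), fun s n hs hsv => ?_⟩
  have hl : ‖((1 - s ^ 2 * v / 2 : ℝ) : ℂ)‖ ≤ 1 := by
    have : 0 ≤ s ^ 2 * v := by positivity
    rw [Complex.norm_real, Real.norm_eq_abs, abs_le]
    constructor <;> linarith
  have hbound := h.norm_integral_exp_sum_sub_pow_le (hψ.measurable_source.const_mul s)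
    (measurable_approxEigenfunction hψ.measurable hb.measurable s)
    (fun x => norm_approxEigenfunction_sub_one_le (hA x) (hB x) hs) hl
    (norm_twistedOperator_approxEigenfunction_sub_le hψ hb hA hB hs) n
  simp_rw [← Finset.mul_sum] at hbound
  calc _ ≤ n * (C * |s| ^ 3) + 2 * ((A + B / 2) * |s|) := hbound
    _ = C * (n * |s| ^ 3) + 2 * (A + B / 2) * |s| := by ring
    _ ≤ max C (2 * (A + B / 2)) * (n * |s| ^ 3) + max C (2 * (A + B / 2)) * |s| := by
        gcongr
        · exact le_max_left _ _
        · exact le_max_right _ _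
    _ = _ := by ring

theorem tendstoInDistribution_sum_div_sqrt (h : IsMarkovChain p ν P Y)
    (hψ : IsPoissonSolution p φ ψ) (hb : IsPoissonSolution p (fun x => Var[ψ; p x] - v) b) :
    TendstoInDistribution (fun (n : ℕ) ω => (∑ k ∈ Finset.range n, φ (Y k ω)) / √(n : ℝ)) atTop
      (id : ℝ → ℝ) (fun _ => P) (gaussianReal 0 v) := by
  have hmeas (n : ℕ) : Measurable fun ω => (∑ k ∈ Finset.range n, φ (Y k ω)) / √(n : ℝ) :=
    (h.measurable_sum hψ.measurable_source n).div_const _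
  refine ⟨fun n => (hmeas n).aemeasurable, aemeasurable_id, ?_⟩
  refine ProbabilityMeasure.tendsto_iff_tendsto_charFun.2 fun t => ?_
  obtain ⟨K, hK⟩ := h.exists_norm_integral_exp_mul_sum_sub_pow_le hψ hb
  convert tendsto_div_sqrt_of_norm_sub_pow_le (F := fun s n => ∫ ω, Complex.exp
    ((s * ∑ k ∈ Finset.range n, φ (Y k ω) : ℝ) * Complex.I) ∂P) hK t using 2 with n
  · simp only [ProbabilityMeasure.coe_mk]
    rw [charFun_apply_real, integral_map (hmeas n).aemeasurable (by fun_prop)]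
    congr 1 with ω
    push_cast
    ring_nf
  · simp [charFun_gaussianReal]

end IsMarkovChain

instance (α : ℝ) : IsMarkovKernel (rotationKernel α) where
  isProbabilityMeasure x := ⟨by
    change ((2⁻¹ : ℝ≥0∞) • Measure.dirac (x + (α : UnitAddCircle)) +
      (2⁻¹ : ℝ≥0∞) • Measure.dirac (x - (α : UnitAddCircle))) Set.univ = 1
    simp [ENNReal.inv_two_add_inv_two]⟩

lemma integral_rotationKernel {E : Type*} [NormedAddCommGroup E] [NormedSpace ℝ E]
    [CompleteSpace E] (α : ℝ) (f : UnitAddCircle → E) (x : UnitAddCircle) :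
    ∫ y, f y ∂rotationKernel α x =
      (2⁻¹ : ℝ) • (f (x + (α : UnitAddCircle)) + f (x - (α : UnitAddCircle))) := by
  have hi (z : UnitAddCircle) : Integrable f ((2⁻¹ : ℝ≥0∞) • Measure.dirac z) :=
    (integrable_dirac (by finiteness)).smul_measure (by simp)
  change ∫ y, f y ∂((2⁻¹ : ℝ≥0∞) • Measure.dirac (x + (α : UnitAddCircle)) +
    (2⁻¹ : ℝ≥0∞) • Measure.dirac (x - (α : UnitAddCircle))) = _
  rw [integral_add_measure (hi _) (hi _), integral_smul_measure, integral_smul_measure,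
    integral_dirac, integral_dirac, smul_add, ENNReal.toReal_inv, ENNReal.toReal_ofNat]

lemma variance_rotationKernel (α : ℝ) {f : UnitAddCircle → ℝ} (hf : Measurable f)
    (x : UnitAddCircle) :
    Var[f; rotationKernel α x] =
      (2⁻¹ * (f (x + (α : UnitAddCircle)) - f (x - (α : UnitAddCircle)))) ^ 2 := by
  rw [variance_eq_integral hf.aemeasurable, integral_rotationKernel, integral_rotationKernel]
  simp only [smul_eq_mul]
  ring

lemma fourier_apply_add {T : ℝ} (n : ℤ) (x y : AddCircle T) :
    fourier n (x + y) = fourier n x * fourier n y := by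
  simp only [fourier_apply, smul_add, AddCircle.toCircle_add, Circle.coe_mul]

lemma integral_fourier_eq_zero {T : ℝ} [hT : Fact (0 < T)] {n : ℤ} (hn : n ≠ 0) :
    ∫ x : AddCircle T, fourier n x = 0 :=
  integral_eq_zero_of_add_right_eq_neg (fourier_add_half_inv_index hn hT.out)

lemma integral_fourier_rotationKernel (α : ℝ) (n : ℤ) (x : UnitAddCircle) :
    ∫ y, fourier n y ∂rotationKernel α x = Real.cos (2 * Real.pi * n * α) * fourier n x := by
  have hexp (a : ℝ) : fourier n (a : UnitAddCircle) =
      Complex.exp (2 * Real.pi * n * a * Complex.I) := by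
    rw [fourier_coe_apply]
    congr 1
    push_cast
    ring
  rw [integral_rotationKernel, sub_eq_add_neg, ← AddCircle.coe_neg, fourier_apply_add,
    fourier_apply_add, hexp, hexp, Complex.ofReal_cos, Complex.cos, Complex.real_smul]
  push_cast
  ring_nf

lemma cos_two_pi_int_mul_irrational_ne_one {α : ℝ} (hα : Irrational α) {n : ℤ} (hn : n ≠ 0) :
    Real.cos (2 * Real.pi * n * α) ≠ 1 := by
  intro h
  obtain ⟨k, hk⟩ := (Real.cos_eq_one_iff _).1 h
  refine (hα.intCast_mul hn).ne_int k (mul_left_cancel₀ Real.two_pi_pos.ne' ?_)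
  linarith

lemma sum_smul_fourier_mem_fourierSubalgebra {T : ℝ} (s : Finset ℤ) (c : ℤ → ℂ) :
    ∑ n ∈ s, c n • fourier n ∈ fourierSubalgebra (T := T) :=
  sum_mem fun n _ => SMulMemClass.smul_mem _ (Algebra.subset_adjoin ⟨n, rfl⟩)

lemma isTrigPolynomial_iff_exists_mem_fourierSubalgebra {φ : UnitAddCircle → ℝ} :
    IsTrigPolynomial φ ↔ ∃ F ∈ fourierSubalgebra (T := 1), ∀ x, (φ x : ℂ) = F x := by
  constructor
  · rintro ⟨c, hc⟩
    exact ⟨_, sum_smul_fourier_mem_fourierSubalgebra c.support c,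
      fun x => by simp [hc, ContinuousMap.sum_apply]⟩
  · rintro ⟨F, hF, hφ⟩
    have hspan : F ∈ Submodule.span ℂ (Set.range (fourier (T := 1))) :=
      fourierSubalgebra_coe (T := 1) ▸ hF
    obtain ⟨c, rfl⟩ := Finsupp.mem_span_range_iff_exists_finsupp.1 hspan
    exact ⟨c, fun x => by simp [hφ, Finsupp.sum, ContinuousMap.sum_apply]⟩

lemma isTrigPolynomial_re {F : C(UnitAddCircle, ℂ)} (hF : F ∈ fourierSubalgebra) :
    IsTrigPolynomial fun x => (F x).re := by
  refine isTrigPolynomial_iff_exists_mem_fourierSubalgebra.2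
    ⟨(2⁻¹ : ℂ) • (F + star F), SMulMemClass.smul_mem _ (add_mem hF (star_mem hF)), fun x => ?_⟩
  simp [Complex.re_eq_add_conj, div_eq_inv_mul]

lemma integral_sum_mul_fourier {T : ℝ} [Fact (0 < T)] (μ : Measure (AddCircle T))
    [IsFiniteMeasure μ] (s : Finset ℤ) (c : ℤ → ℂ) :
    ∫ x, ∑ n ∈ s, c n * fourier n x ∂μ = ∑ n ∈ s, c n * ∫ x, fourier n x ∂μ := by
  rw [integral_finsetSum]
  · simp_rw [integral_const_mul]
  · exact fun n _ => Continuous.integrable_of_hasCompactSupport (by fun_prop) (.of_compactSpace _)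

namespace IsTrigPolynomial

variable {φ ψ : UnitAddCircle → ℝ}

lemma continuous (hφ : IsTrigPolynomial φ) : Continuous φ := by
  obtain ⟨F, -, hF⟩ := isTrigPolynomial_iff_exists_mem_fourierSubalgebra.1 hφ
  have hre : φ = fun x => (F x).re := funext fun x => by rw [← hF, Complex.ofReal_re]
  rw [hre]
  fun_prop

lemma comp_add_right (hφ : IsTrigPolynomial φ) (a : UnitAddCircle) :
    IsTrigPolynomial fun x => φ (x + a) := by
  obtain ⟨c, hc⟩ := hφ
  refine isTrigPolynomial_iff_exists_mem_fourierSubalgebra.2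
    ⟨_, sum_smul_fourier_mem_fourierSubalgebra c.support fun n => c n * fourier n a, fun x => ?_⟩
  rw [hc, ContinuousMap.sum_apply]
  refine Finset.sum_congr rfl fun n _ => ?_
  rw [fourier_apply_add, ContinuousMap.smul_apply, smul_eq_mul]
  ring

lemma variance_rotationKernel (hψ : IsTrigPolynomial ψ) (α : ℝ) :
    IsTrigPolynomial fun x => Var[ψ; rotationKernel α x] := by
  obtain ⟨F, hF, hFψ⟩ := isTrigPolynomial_iff_exists_mem_fourierSubalgebra.1
    (hψ.comp_add_right (α : UnitAddCircle))
  obtain ⟨G, hG, hGψ⟩ := isTrigPolynomial_iff_exists_mem_fourierSubalgebra.1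
    (hψ.comp_add_right (-(α : UnitAddCircle)))
  refine isTrigPolynomial_iff_exists_mem_fourierSubalgebra.2 ⟨((2⁻¹ : ℂ) • (F - G)) ^ 2,
    pow_mem (SMulMemClass.smul_mem _ (sub_mem hF hG)) 2, fun x => ?_⟩
  rw [_root_.variance_rotationKernel α hψ.continuous.measurable]
  simp [hFψ, hGψ, sub_eq_add_neg x]

lemma exists_isPoissonSolution {α : ℝ} (hα : Irrational α) (hφ : IsTrigPolynomial φ) :
    ∃ ψ, IsTrigPolynomial ψ ∧
      IsPoissonSolution (rotationKernel α) (fun x => φ x - ∫ y, φ y) ψ := by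
  obtain ⟨c, hc⟩ := hφ
  -- The inverse at `n = 0` is that of `0`, hence `0`: this discards the mean of `φ`.
  let d (n : ℤ) : ℂ := c n * ((1 - Real.cos (2 * Real.pi * n * α) : ℝ) : ℂ)⁻¹
  let g : C(UnitAddCircle, ℂ) := ∑ n ∈ c.support, d n • fourier n
  have hg (x : UnitAddCircle) : g x = ∑ n ∈ c.support, d n * fourier n x := by
    simp [g, ContinuousMap.sum_apply]
  have hterm (n : ℤ) (x : UnitAddCircle) :
      d n * fourier n x - d n * ∫ y, fourier n y ∂rotationKernel α x =
        c n * fourier n x - c n * ∫ y : UnitAddCircle, fourier n y := by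
    rw [integral_fourier_rotationKernel]
    obtain rfl | hn := eq_or_ne n 0
    · simp [d, measureReal_def]
    · have hne : ((1 - Real.cos (2 * Real.pi * n * α) : ℝ) : ℂ) ≠ 0 :=
        Complex.ofReal_ne_zero.2 (sub_ne_zero.2 (cos_two_pi_int_mul_irrational_ne_one hα hn).symm)
      rw [integral_fourier_eq_zero hn, mul_zero, sub_zero, ← mul_sub, ← one_sub_mul,
        ← Complex.ofReal_one, ← Complex.ofReal_sub, ← mul_assoc, inv_mul_cancel_right₀ hne]
  have hpoisson (x : UnitAddCircle) :
      g x - ∫ y, g y ∂rotationKernel α x = (φ x - ∫ y, φ y : ℝ) := by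
    simp only [hg, Complex.ofReal_sub, ← integral_complex_ofReal, hc, integral_sum_mul_fourier,
      ← Finset.sum_sub_distrib, hterm]
  refine ⟨fun x => (g x).re, isTrigPolynomial_re (sum_smul_fourier_mem_fourierSubalgebra _ _),
    by fun_prop, ⟨‖g‖, fun x => (Complex.abs_re_le_norm _).trans (g.norm_coe_le_norm x)⟩,
    fun x => ?_⟩
  simpa [integral_rotationKernel, mul_add] using congrArg Complex.re (hpoisson x)

end IsTrigPolynomial

lemma eq_of_periodic_of_denseRange_zsmul {G X : Type*} [TopologicalSpace G] [AddGroup G]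
    [TopologicalSpace X] [T2Space X] {f : G → X} {a : G} (hf : Continuous f)
    (hfa : Function.Periodic f a) (ha : DenseRange (· • a : ℤ → G)) (x : G) : f x = f 0 := by
  refine congrFun (ha.equalizer hf continuous_const (funext fun n => ?_)) x
  exact hfa.zsmul_eq n

lemma exists_eq_const_of_variance_rotationKernel_eq_zero {α : ℝ} (hα : Irrational α)
    {ψ : UnitAddCircle → ℝ} (hψ : Continuous ψ) (hvar : ∀ x, Var[ψ; rotationKernel α x] = 0) :
    ∃ c, ∀ x, ψ x = c := by
  have hperiodic : Function.Periodic ψ ((α + α : ℝ) : UnitAddCircle) := fun x => by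
    have h := hvar (x + (α : UnitAddCircle))
    rw [variance_rotationKernel α hψ.measurable] at h
    simpa [sub_eq_zero, add_assoc] using h
  have hdense : DenseRange (· • ((α + α : ℝ) : UnitAddCircle) : ℤ → UnitAddCircle) :=
    AddCircle.denseRange_zsmul_coe_iff.2
      (by simpa [← two_mul] using hα.natCast_mul two_ne_zero)
  exact ⟨ψ 0, eq_of_periodic_of_denseRange_zsmul hψ hperiodic hdense⟩

lemma integral_variance_rotationKernel_pos {α : ℝ} (hα : Irrational α) {ψ : UnitAddCircle → ℝ}
    (hψ : Continuous ψ) (hconst : ¬ ∃ c, ∀ x, ψ x = c) :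
    0 < ∫ x, Var[ψ; rotationKernel α x] := by
  have hcont : Continuous fun x => Var[ψ; rotationKernel α x] := by
    simp_rw [variance_rotationKernel α hψ.measurable]
    fun_prop
  obtain ⟨x, hx⟩ : ∃ x, Var[ψ; rotationKernel α x] ≠ 0 := by
    by_contra! h
    exact hconst (exists_eq_const_of_variance_rotationKernel_eq_zero hα hψ h)
  exact hcont.integral_pos_of_hasCompactSupport_nonneg_nonzero (.of_compactSpace _)
    (fun _ => variance_nonneg _ _) hx

theorem proposition2_general (α : ℝ) (hα : Irrational α)
    (φ : UnitAddCircle → ℝ) (hφ : IsTrigPolynomial φ) (hφ_nonconst : ¬ ∃ c : ℝ, ∀ x, φ x = c) :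
    ∃ σ : ℝ, 0 < σ ∧
      ∀ (Ω : Type*) [MeasurableSpace Ω] (P : Measure Ω) [IsProbabilityMeasure P]
        (ν : Measure UnitAddCircle) (Y : ℕ → Ω → UnitAddCircle),
        IsMarkovChain (rotationKernel α) ν P Y →
        TendstoInDistribution
          (fun (n : ℕ) ω => (∑ k ∈ Finset.range n, (φ (Y k ω) - ∫ x, φ x)) / √(n : ℝ)) atTop
          (id : ℝ → ℝ) (fun _ => P) (gaussianReal 0 (σ ^ 2).toNNReal) := by
  obtain ⟨ψ, hψ_trig, hψ⟩ := hφ.exists_isPoissonSolution hα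
  obtain ⟨b, -, hb⟩ := (hψ_trig.variance_rotationKernel α).exists_isPoissonSolution hα
  have hψ_nonconst : ¬ ∃ c, ∀ x, ψ x = c := fun ⟨c, hc⟩ => by
    refine hφ_nonconst ⟨∫ y, φ y, fun x => ?_⟩
    simpa [hc, sub_eq_zero, eq_comm (a := (0 : ℝ))] using hψ.sub_integral_eq x
  have hv : 0 < ∫ x, Var[ψ; rotationKernel α x] :=
    integral_variance_rotationKernel_pos hα hψ_trig.continuous hψ_nonconst
  refine ⟨√(∫ x, Var[ψ; rotationKernel α x]), Real.sqrt_pos.2 hv, fun Ω _ P _ ν Y hY => ?_⟩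
  refine hY.tendstoInDistribution_sum_div_sqrt hψ (b := b) ?_
  rwa [Real.sq_sqrt hv.le, Real.coe_toNNReal _ hv.le]

theorem proposition2 (α : ℝ) (hα : Irrational α)
    (φ : UnitAddCircle → ℝ) (hφ : IsTrigPolynomial φ)
    (hφ_nonconst : ¬ ∃ c : ℝ, ∀ x, φ x = c) (hφ_mean : ∫ x, φ x = 0) :
    ∃ σ : ℝ, 0 < σ ∧
      ∀ (Ω : Type*) [MeasurableSpace Ω] (P : Measure Ω) [IsProbabilityMeasure P]
        (Y : ℕ → Ω → UnitAddCircle), IsMarkovChain (rotationKernel α) volume P Y →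
        TendstoInDistribution
          (fun (n : ℕ) ω => (∑ k ∈ Finset.range n, φ (Y k ω)) / √(n : ℝ)) atTop
          (id : ℝ → ℝ) (fun _ => P) (gaussianReal 0 (σ ^ 2).toNNReal) := by
  obtain ⟨σ, hσ, h⟩ := proposition2_general α hα φ hφ hφ_nonconst
  exact ⟨σ, hσ, fun Ω _ P _ Y hY => by simpa [hφ_mean] using h Ω P volume Y hY⟩
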